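/- **Proposition 3.6.** Let $G$ be a countable discrete group and $\varphi:G\to G$ an injective endomorphism such that $G/\varphi(G)$ (the set of left cosets) is finite. Let $\mathbb U[\varphi]$ be the universal unital C$^*$-algebra generated by unitaries $u_g$ ($g\in G$) and an isometry $s$ subject to $$u_gu_h=u_{gh},\qquad su_g=u_{\varphi(g)}s,\qquad \sum_{g\in G/\varphi(G)}u_gss^*u_{g^{-1}}=1\qquad(g,h\in G),$$ let $P=\{u_gs^ns^{*n}u_{g^{-1}}: g\in G,\ n\in\mathbb N\}$ (with $0\in\mathbb N$), and let $C^*(P)\subseteq\mathbb U[\varphi]$ be the C$^*$-subalgebra generated by $P$. For a unital C$^*$-algebra $A$, a monoid $S$ and a homomorphism $\alpha$ from $S$ to the monoid of (not necessarily unital) $*$-endomorphisms of $A$, the crossed product $A\rtimes_\alpha S$ is the universal unital C$^*$-algebra generated by the images of a unital $*$-homomorphism $\iota_A$ on $A$ and of a unital homomorphism $\iota_S$ from $S$ to the isometries, subject to $\iota_S(t)\iota_A(a)\iota_S(t)^*=\iota_A(\alpha_t(a))$ for $t\in S$, $a\in A$. If $S$ is a group, this is the full group crossed product, and we write $a\delta_t=\iota_A(a)\iota_S(t)$.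 Let $\omega$ be the action of $G$ on $C^*(P)$ given by $\omega_g(a)=u_gau_{g^{-1}}$. Then there is a unique action $\tau$ of the semigroup $\mathbb N$ on $C^*(P)\rtimes_\omega G$ by $*$-endomorphisms such that $$\tau_n(a\delta_g)=(s^nas^{*n})\,\delta_{\varphi^n(g)}\qquad(n\in\mathbb N,\ a\in C^*(P),\ g\in G),$$ and $\mathbb U[\varphi]$ is isomorphic, as a C$^*$-algebra, to $(C^*(P)\rtimes_\omega G)\rtimes_\tau\mathbb N$. -/

import Mathlib

open scoped NNReal ComplexConjugate

noncomputable section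

universe u v

/-! ### The free unital complex `*`-algebra on a set of generators -/

/-- The free unital complex `*`-algebra on `X`: the algebra of the free monoid on the letters
`(x, true)`, standing for the generator `x`, and `(x, false)`, standing for its adjoint `x⋆`. -/
def FreeStar (X : Type u) : Type u := MonoidAlgebra ℂ (FreeMonoid (X × Bool))

namespace FreeStar

variable {X : Type u}

instance : Ring (FreeStar X) := inferInstanceAs (Ring (MonoidAlgebra ℂ (FreeMonoid (X × Bool))))

instance : Algebra ℂ (FreeStar X) :=
  inferInstanceAs (Algebra ℂ (MonoidAlgebra ℂ (FreeMonoid (X × Bool))))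

/-- A word, as an element of the free `*`-algebra. -/
def word : FreeMonoid (X × Bool) →* FreeStar X := MonoidAlgebra.of ℂ (FreeMonoid (X × Bool))

/-- The generator `x`. -/
def gen (x : X) : FreeStar X := word (FreeMonoid.of (x, true))

/-- Scalars, conjugated, in the opposite of the free `*`-algebra. -/
def conjScalar : ℂ →+* (FreeStar X)ᵐᵒᵖ :=
  ((algebraMap ℂ (FreeStar X)).comp (starRingEnd ℂ)).toOpposite
    fun a b => Algebra.commute_algebraMap_left (conj a) (algebraMap ℂ (FreeStar X) (conj b))

/-- Words, reversed and with every letter replaced by its adjoint. -/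
def revWord : FreeMonoid (X × Bool) →* (FreeStar X)ᵐᵒᵖ :=
  FreeMonoid.lift fun p : X × Bool => MulOpposite.op (word (FreeMonoid.of (p.1, !p.2)))

theorem commute_conjScalar (c : ℂ) (w : FreeMonoid (X × Bool)) :
    Commute (conjScalar c) (revWord w) :=
  MulOpposite.unop_injective
    (Algebra.commute_algebraMap_right (conj c) (revWord w).unop : Commute _ _)

/-- The involution as a ring homomorphism to the opposite ring: it conjugates the scalars,
exchanges each generator with its adjoint, and reverses words. -/
def starHom : FreeStar X →+* (FreeStar X)ᵐᵒᵖ :=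
  MonoidAlgebra.liftNCRingHom (k := ℂ) (G := FreeMonoid (X × Bool)) (R := (FreeStar X)ᵐᵒᵖ)
    conjScalar revWord commute_conjScalar

instance : Star (FreeStar X) := ⟨fun a => (starHom a).unop⟩

theorem star_def (a : FreeStar X) : star a = (starHom a).unop := rfl

theorem star_algebraMap (c : ℂ) :
    star (algebraMap ℂ (FreeStar X) c) = algebraMap ℂ (FreeStar X) (conj c) := by
  have h : starHom (algebraMap ℂ (FreeStar X) c)
      = MulOpposite.op (algebraMap ℂ (FreeStar X) (conj c)) * 1 :=
    (MonoidAlgebra.liftNCRingHom_single _ _ _ _ _).trans (by rw [map_one]; rfl)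
  rw [star_def, h, mul_one]; rfl

theorem star_letter (x : X) (b : Bool) :
    star (word (FreeMonoid.of (x, b))) = word (FreeMonoid.of (x, !b)) := by
  have h : starHom (word (FreeMonoid.of (x, b)))
      = 1 * MulOpposite.op (word (FreeMonoid.of (x, !b))) :=
    (MonoidAlgebra.liftNCRingHom_single _ _ _ _ _).trans (by rw [map_one, revWord, FreeMonoid.lift_eval_of])
  rw [star_def, h, one_mul]; rfl

theorem star_mul' (a b : FreeStar X) : star (a * b) = star b * star a := by
  simp [star_def]

theorem star_add' (a b : FreeStar X) : star (a + b) = star a + star b := by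
  simp [star_def]

/-- Every element of the free `*`-algebra is built from scalars and letters by sums and products. -/
theorem induction {p : FreeStar X → Prop} (hc : ∀ c : ℂ, p (algebraMap ℂ _ c))
    (hl : ∀ x b, p (word (FreeMonoid.of (x, b)))) (ha : ∀ a b, p a → p b → p (a + b))
    (hm : ∀ a b, p a → p b → p (a * b)) (a : FreeStar X) : p a := by
  have hw : ∀ w : FreeMonoid (X × Bool), p (word w) := fun w => by
    induction w using FreeMonoid.inductionOn with
    | one => simpa using hc 1
    | of y => exact hl y.1 y.2
    | mul v w hv hw => rw [map_mul]; exact hm _ _ hv hw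
  refine MonoidAlgebra.induction_on (motive := p) a hw ha fun c f hf => ?_
  have h := hm _ _ (hc c) hf
  exact (Algebra.smul_def (A := FreeStar X) c f).symm ▸ h

theorem star_star' (a : FreeStar X) : star (star a) = a := by
  induction a using FreeStar.induction with
  | hc c => simp [star_algebraMap]
  | hl x b => simp [star_letter]
  | ha a b h h' => rw [star_add', star_add', h, h']
  | hm a b h h' => rw [star_mul', star_mul', h, h']

instance : StarRing (FreeStar X) where
  star_involutive := star_star'
  star_mul := star_mul'
  star_add := star_add'

instance : StarModule ℂ (FreeStar X) where
  star_smul c a := by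
    rw [Algebra.smul_def, star_mul, star_algebraMap, Algebra.smul_def, Algebra.commutes]; rfl

end FreeStar

/-! ### Universal C*-algebras given by generators and relations -/

/-- A presentation of a unital C*-algebra: a set `X` of generators, an a priori bound for the norm
of every generator, and relations between `*`-polynomials in the generators. -/
structure CStarPresentation (X : Type u) where
  /-- the norm of the generator `x` is at most `bound x` -/
  bound : X → ℝ≥0
  /-- the relations `a = b` that are imposed -/
  rel : FreeStar X → FreeStar X → Prop

namespace CStarPresentation

variable {X : Type u} (R : CStarPresentation X)

/-- A C*-seminorm on the free `*`-algebra that respects the bounds and the relations of `R`. -/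
structure IsAdmissible (p : Seminorm ℂ (FreeStar X)) : Prop where
  mul_le : ∀ a b, p (a * b) ≤ p a * p b
  star_mul_self : ∀ a, p (star a * a) = p a * p a
  gen_le : ∀ x, p (FreeStar.gen x) ≤ R.bound x
  rel_eq : ∀ a b, R.rel a b → p (a - b) = 0

theorem isAdmissible_zero : R.IsAdmissible 0 := by
  constructor <;> simp

instance : Nonempty {p : Seminorm ℂ (FreeStar X) // R.IsAdmissible p} := ⟨⟨0, R.isAdmissible_zero⟩⟩

variable {R} in
theorem IsAdmissible.star_le {p : Seminorm ℂ (FreeStar X)} (hp : R.IsAdmissible p)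
    (a : FreeStar X) : p (star a) ≤ p a := by
  have h := hp.star_mul_self (star a)
  rw [star_star] at h
  have h' := hp.mul_le a (star a)
  rw [h] at h'
  by_contra! hlt
  nlinarith [apply_nonneg p a, apply_nonneg p (star a)]

theorem bddAbove (a : FreeStar X) :
    BddAbove (Set.range fun p : {p : Seminorm ℂ (FreeStar X) // R.IsAdmissible p} => p.1 a) := by
  suffices h : ∃ C : ℝ, ∀ p : Seminorm ℂ (FreeStar X), R.IsAdmissible p → p a ≤ C by
    obtain ⟨C, hC⟩ := h
    exact ⟨C, by rintro _ ⟨p, rfl⟩; exact hC p.1 p.2⟩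
  induction a using FreeStar.induction with
  | hc c =>
    refine ⟨‖c‖, fun p hp => ?_⟩
    have h1 : p 1 ≤ 1 := by
      have h := hp.star_mul_self 1
      rw [star_one, one_mul] at h
      nlinarith [apply_nonneg p (1 : FreeStar X)]
    rw [Algebra.algebraMap_eq_smul_one, map_smul_eq_mul]
    exact mul_le_of_le_one_right (norm_nonneg c) h1
  | hl x b =>
    refine ⟨R.bound x, fun p hp => ?_⟩
    cases b with
    | true => exact hp.gen_le x
    | false =>
      have h := hp.star_le (FreeStar.gen x)
      rw [FreeStar.gen, FreeStar.star_letter] at h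
      exact h.trans (hp.gen_le x)
  | ha a b h h' =>
    obtain ⟨C, hC⟩ := h
    obtain ⟨D, hD⟩ := h'
    exact ⟨C + D, fun p hp => (map_add_le_add p a b).trans (add_le_add (hC p hp) (hD p hp))⟩
  | hm a b h h' =>
    obtain ⟨C, hC⟩ := h
    obtain ⟨D, hD⟩ := h'
    exact ⟨C * D, fun p hp => (hp.mul_le a b).trans (mul_le_mul (hC p hp) (hD p hp)
      (apply_nonneg p b) ((apply_nonneg p a).trans (hC p hp)))⟩

/-- The free `*`-algebra on the generators, to carry the largest admissible C*-seminorm. -/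
def Pre (_ : CStarPresentation X) : Type u := FreeStar X

instance : Ring R.Pre := inferInstanceAs (Ring (FreeStar X))
instance : Algebra ℂ R.Pre := inferInstanceAs (Algebra ℂ (FreeStar X))
instance : StarRing R.Pre := inferInstanceAs (StarRing (FreeStar X))
instance : StarModule ℂ R.Pre := inferInstanceAs (StarModule ℂ (FreeStar X))

/-- The largest admissible C*-seminorm. -/
instance : Norm R.Pre :=
  ⟨fun a => ⨆ p : {p : Seminorm ℂ (FreeStar X) // R.IsAdmissible p}, p.1 a⟩

theorem norm_def (a : R.Pre) :
    ‖a‖ = ⨆ p : {p : Seminorm ℂ (FreeStar X) // R.IsAdmissible p}, p.1 a := rfl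

variable {R} in
theorem IsAdmissible.le_norm {p : Seminorm ℂ (FreeStar X)} (hp : R.IsAdmissible p) (a : R.Pre) :
    p a ≤ ‖a‖ :=
  le_ciSup (R.bddAbove a) ⟨p, hp⟩

theorem norm_nonneg' (a : R.Pre) : 0 ≤ ‖a‖ := R.isAdmissible_zero.le_norm a

theorem norm_le_of {a : R.Pre} {C : ℝ}
    (h : ∀ p : Seminorm ℂ (FreeStar X), R.IsAdmissible p → p a ≤ C) : ‖a‖ ≤ C :=
  ciSup_le fun p => h p.1 p.2

theorem norm_add_le' (a b : R.Pre) : ‖a + b‖ ≤ ‖a‖ + ‖b‖ :=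
  R.norm_le_of fun p hp =>
    (map_add_le_add p a b).trans (add_le_add (hp.le_norm a) (hp.le_norm b))

theorem norm_mul_le' (a b : R.Pre) : ‖a * b‖ ≤ ‖a‖ * ‖b‖ :=
  R.norm_le_of fun p hp => (hp.mul_le a b).trans
    (mul_le_mul (hp.le_norm a) (hp.le_norm b) (apply_nonneg p b) (R.norm_nonneg' a))

theorem norm_smul_le' (c : ℂ) (a : R.Pre) : ‖c • a‖ ≤ ‖c‖ * ‖a‖ :=
  R.norm_le_of fun p hp => (map_smul_eq_mul p c a).le.trans
    (mul_le_mul_of_nonneg_left (hp.le_norm a) (norm_nonneg c))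

theorem norm_star_le' (a : R.Pre) : ‖star a‖ ≤ ‖a‖ :=
  R.norm_le_of fun _ hp => (hp.star_le a).trans (hp.le_norm a)

theorem norm_mul_self_le' (a : R.Pre) : ‖a‖ * ‖a‖ ≤ ‖star a * a‖ := by
  have h : ‖a‖ ≤ √‖star a * a‖ := R.norm_le_of fun p hp =>
    Real.le_sqrt_of_sq_le (((sq (p a)).trans (hp.star_mul_self a).symm).trans_le
      (hp.le_norm (star a * a : R.Pre)))
  calc ‖a‖ * ‖a‖ ≤ √‖star a * a‖ * √‖star a * a‖ :=
        mul_self_le_mul_self (R.norm_nonneg' a) h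
    _ = ‖star a * a‖ := Real.mul_self_sqrt (R.norm_nonneg' _)

instance : SeminormedRing R.Pre where
  __ := (inferInstance : Ring R.Pre)
  __ := SeminormedAddCommGroup.ofCore (𝕜 := ℂ) (E := R.Pre)
    { norm_nonneg := R.norm_nonneg'
      norm_smul := fun c a => by
        refine le_antisymm (R.norm_smul_le' c a) ?_
        rcases eq_or_ne c 0 with rfl | hc
        · simpa using R.norm_nonneg' _
        · have h := R.norm_smul_le' c⁻¹ (c • a)
          rw [inv_smul_smul₀ hc, norm_inv] at h
          rwa [← div_eq_inv_mul, le_div_iff₀' (norm_pos_iff.2 hc)] at h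
      norm_triangle := R.norm_add_le' }
  norm_mul_le := R.norm_mul_le'

instance : NormedAlgebra ℂ R.Pre where
  norm_smul_le := R.norm_smul_le'

theorem norm_star_pre (a : R.Pre) : ‖star a‖ = ‖a‖ :=
  le_antisymm (R.norm_star_le' a) (by simpa using R.norm_star_le' (star a))

theorem isometry_star_pre : Isometry (star : R.Pre → R.Pre) :=
  AddMonoidHomClass.isometry_of_norm (starAddEquiv : R.Pre ≃+ R.Pre) R.norm_star_pre

/-- The universal unital C*-algebra of a presentation: the Hausdorff completion of the free
`*`-algebra on the generators for the largest C*-seminorm that respects the relations. -/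
def Universal : Type u := UniformSpace.Completion R.Pre

namespace Universal

open UniformSpace

instance : NormedRing R.Universal := inferInstanceAs (NormedRing (Completion R.Pre))
instance : CompleteSpace R.Universal := inferInstanceAs (CompleteSpace (Completion R.Pre))
instance : Algebra ℂ R.Universal := inferInstanceAs (Algebra ℂ (Completion R.Pre))

instance : NormedAlgebra ℂ R.Universal where
  norm_smul_le := norm_smul_le (α := ℂ) (β := Completion R.Pre)

/-- The canonical map of the free `*`-algebra. -/
def coe : FreeStar X →ₐ[ℂ] R.Universal where
  toRingHom := (Completion.coeRingHom : R.Pre →+* Completion R.Pre)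
  commutes' _ := rfl

theorem denseRange_coe : DenseRange (coe R) := Completion.denseRange_coe (α := R.Pre)

theorem norm_coe (a : FreeStar X) : ‖coe R a‖ = ‖(show R.Pre from a)‖ :=
  Completion.norm_coe (E := R.Pre) a

instance : Star R.Universal :=
  ⟨(Completion.map (star : R.Pre → R.Pre) : Completion R.Pre → Completion R.Pre)⟩

theorem star_coe (a : FreeStar X) : star (coe R a) = coe R (star a) :=
  Completion.map_coe R.isometry_star_pre.uniformContinuous a

theorem continuous_star' : Continuous (star : R.Universal → R.Universal) :=
  Completion.continuous_map

/-- An identity between continuous functions holds if it holds on the free `*`-algebra. -/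
theorem induction {p : R.Universal → Prop} (hp : IsClosed {x | p x})
    (h : ∀ a : FreeStar X, p (coe R a)) (x : R.Universal) : p x :=
  Completion.induction_on (α := R.Pre) x hp h

instance : StarRing R.Universal where
  star_involutive := by
    intro x
    induction x using induction with
    | hp => exact isClosed_eq ((continuous_star' R).comp (continuous_star' R)) continuous_id
    | h a => rw [star_coe, star_coe, star_star]
  star_mul := by
    intro x y
    induction x using induction with
    | hp => exact isClosed_eq ((continuous_star' R).comp (by fun_prop))
              (continuous_const.mul (continuous_star' R))
    | h a =>
      induction y using induction with
      | hp => exact isClosed_eq ((continuous_star' R).comp (by fun_prop))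
                ((continuous_star' R).mul continuous_const)
      | h b =>
        rw [← map_mul, star_coe, star_coe, star_coe, ← map_mul, star_mul]
  star_add := by
    intro x y
    induction x using induction with
    | hp => exact isClosed_eq ((continuous_star' R).comp (by fun_prop))
              ((continuous_star' R).add continuous_const)
    | h a =>
      induction y using induction with
      | hp => exact isClosed_eq ((continuous_star' R).comp (by fun_prop))
                (continuous_const.add (continuous_star' R))
      | h b =>
        rw [← map_add, star_coe, star_coe, star_coe, ← map_add, star_add]

instance : StarModule ℂ R.Universal where
  star_smul c x := by
    induction x using induction with
    | hp => exact isClosed_eq ((continuous_star' R).comp (continuous_const_smul c))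
              ((continuous_star' R).const_smul (star c))
    | h a =>
      rw [← map_smul, star_coe, star_coe, ← map_smul, star_smul]

instance : CStarRing R.Universal where
  norm_mul_self_le x := by
    induction x using induction with
    | hp => exact isClosed_le (by fun_prop)
              (continuous_norm.comp ((continuous_star' R).mul continuous_id))
    | h a =>
      rw [star_coe, ← map_mul, norm_coe, norm_coe]
      exact R.norm_mul_self_le' a

instance : CStarAlgebra R.Universal where

/-- The image of a generator in the universal C*-algebra. -/
def gen (x : X) : R.Universal := coe R (FreeStar.gen x)

theorem coe_eq_of_rel {a b : FreeStar X} (h : R.rel a b) : coe R a = coe R b := by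
  rw [← sub_eq_zero, ← map_sub, ← norm_le_zero_iff, norm_coe]
  exact R.norm_le_of fun p hp => (hp.rel_eq a b h).le

end Universal

end CStarPresentation

/-! ### The universal C*-algebra of an endomorphism of a group -/

/-- The generators of `𝕌[φ]`. -/
inductive EndoGen (G : Type u) : Type u
  | u (g : G)
  | s

section Endo

attribute [local instance] Subgroup.fintypeQuotientOfFiniteIndex

variable {G : Type u} [Group G]

/-- The relations of `𝕌[φ]`: the `u g` are unitaries with `u g * u h = u (g * h)`, `s` is an
isometry, `s * u g = u (φ g) * s`, and the projections `u g * s * s⋆ * u g⁻¹`, with one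
representative `g` of each left coset of `φ(G)`, add up to `1`. -/
inductive EndoRel (φ : G →* G) [φ.range.FiniteIndex] :
    FreeStar (EndoGen G) → FreeStar (EndoGen G) → Prop
  | u_isometry (g : G) : EndoRel φ (star (.gen (.u g)) * .gen (.u g)) 1
  | u_coisometry (g : G) : EndoRel φ (.gen (.u g) * star (.gen (.u g))) 1
  | s_isometry : EndoRel φ (star (.gen .s) * .gen .s) 1
  | u_mul (g h : G) : EndoRel φ (.gen (.u g) * .gen (.u h)) (.gen (.u (g * h)))
  | s_mul_u (g : G) : EndoRel φ (.gen .s * .gen (.u g)) (.gen (.u (φ g)) * .gen .s)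
  | sum_eq_one : EndoRel φ
      (∑ q : G ⧸ φ.range,
        .gen (.u q.out) * .gen .s * star (.gen .s) * .gen (.u (q.out)⁻¹)) 1

/-- The universal C*-algebra `𝕌[φ]`. The bound `1` for the norms of the generators is no
restriction, as unitaries and isometries have norm at most `1`. -/
abbrev EndoAlgebra (φ : G →* G) [φ.range.FiniteIndex] : Type u :=
  (CStarPresentation.mk (fun _ => 1) (EndoRel φ)).Universal

namespace EndoAlgebra

open CStarPresentation

variable (φ : G →* G) [φ.range.FiniteIndex]

/-- The unitary `u_g` of `𝕌[φ]`. -/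
def u (g : G) : EndoAlgebra φ := Universal.gen _ (.u g)

/-- The isometry `s` of `𝕌[φ]`. -/
def s : EndoAlgebra φ := Universal.gen _ .s

theorem star_u_mul_u (g : G) : star (u φ g) * u φ g = 1 := by
  have h := Universal.coe_eq_of_rel (.mk (fun _ => 1) (EndoRel φ)) (.u_isometry g)
  rwa [map_mul, map_one, ← Universal.star_coe] at h

theorem u_mul_star_u (g : G) : u φ g * star (u φ g) = 1 := by
  have h := Universal.coe_eq_of_rel (.mk (fun _ => 1) (EndoRel φ)) (.u_coisometry g)
  rwa [map_mul, map_one, ← Universal.star_coe] at h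

theorem star_s_mul_s : star (s φ) * s φ = 1 := by
  have h := Universal.coe_eq_of_rel (.mk (fun _ => 1) (EndoRel φ)) .s_isometry
  rwa [map_mul, map_one, ← Universal.star_coe] at h

theorem u_mul_u (g h : G) : u φ g * u φ h = u φ (g * h) := by
  have h := Universal.coe_eq_of_rel (.mk (fun _ => 1) (EndoRel φ)) (.u_mul g h)
  rwa [map_mul] at h

theorem s_mul_u (g : G) : s φ * u φ g = u φ (φ g) * s φ := by
  have h := Universal.coe_eq_of_rel (.mk (fun _ => 1) (EndoRel φ)) (.s_mul_u g)
  rwa [map_mul, map_mul] at h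

theorem u_one : u φ 1 = 1 := by
  calc u φ 1 = star (u φ 1) * u φ 1 * u φ 1 := by rw [star_u_mul_u, one_mul]
    _ = 1 := by rw [mul_assoc, u_mul_u, mul_one, star_u_mul_u]

theorem star_u (g : G) : star (u φ g) = u φ g⁻¹ := by
  calc star (u φ g) = star (u φ g) * (u φ g * u φ g⁻¹) := by
        rw [u_mul_u, mul_inv_cancel, u_one, mul_one]
    _ = u φ g⁻¹ := by rw [← mul_assoc, star_u_mul_u, one_mul]

theorem star_s_pow_mul (n : ℕ) : star (s φ ^ n) * s φ ^ n = 1 := by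
  induction n with
  | zero => simp
  | succ n ih =>
    rw [pow_succ, star_mul, mul_assoc, ← mul_assoc (star (s φ ^ n)), ih, one_mul, star_s_mul_s]

theorem s_pow_mul_u (n : ℕ) (g : G) : s φ ^ n * u φ g = u φ (φ^[n] g) * s φ ^ n := by
  induction n generalizing g with
  | zero => simp
  | succ n ih =>
    rw [pow_succ, mul_assoc, s_mul_u, ← mul_assoc, ih, mul_assoc, Function.iterate_succ_apply]

/-- The projections `u_g sⁿ s⋆ⁿ u_{g⁻¹}`. -/
def projections : Set (EndoAlgebra φ) :=
  {x | ∃ (g : G) (n : ℕ), x = u φ g * s φ ^ n * star (s φ) ^ n * u φ g⁻¹}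

/-- `C*(P)`, the C*-subalgebra of `𝕌[φ]` generated by the set `P` of these projections, which
contains `1`. -/
def diagonal : StarSubalgebra ℂ (EndoAlgebra φ) :=
  (StarAlgebra.adjoin ℂ (projections φ)).topologicalClosure

instance : IsClosed (diagonal φ : Set (EndoAlgebra φ)) :=
  StarSubalgebra.isClosed_topologicalClosure _

theorem projections_subset : projections φ ⊆ diagonal φ :=
  (StarAlgebra.subset_adjoin ℂ _).trans (StarSubalgebra.le_topologicalClosure _)

variable {φ} in
theorem conj_mem {w : EndoAlgebra φ} (hw : star w * w = 1)
    (hP : ∀ x ∈ projections φ, w * x * star w ∈ projections φ)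
    {x : EndoAlgebra φ} (hx : x ∈ diagonal φ) : w * x * star w ∈ diagonal φ := by
  have h1 : w * 1 * star w ∈ diagonal φ :=
    projections_subset φ (hP 1 ⟨1, 0, by simp [u_one]⟩)
  have h : ∀ y ∈ StarAlgebra.adjoin ℂ (projections φ), w * y * star w ∈ diagonal φ := by
    intro y hy
    induction hy using StarAlgebra.adjoin_induction with
    | mem y hy => exact projections_subset φ (hP y hy)
    | algebraMap r =>
      rw [Algebra.algebraMap_eq_smul_one, mul_smul_comm, smul_mul_assoc]
      exact SMulMemClass.smul_mem r h1
    | add a b _ _ ha hb => rw [mul_add, add_mul]; exact add_mem ha hb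
    | mul a b _ _ ha hb =>
      have : w * (a * b) * star w = (w * a * star w) * (w * b * star w) := by
        calc w * (a * b) * star w = w * a * 1 * b * star w := by simp only [mul_one, mul_assoc]
          _ = (w * a * star w) * (w * b * star w) := by rw [← hw]; simp only [mul_assoc]
      rw [this]; exact mul_mem ha hb
    | star a _ ha =>
      have : w * star a * star w = star (w * a * star w) := by simp [mul_assoc]
      rw [this]; exact star_mem ha
  have hc : IsClosed {y | w * y * star w ∈ diagonal φ} :=
    IsClosed.preimage (f := fun y => w * y * star w) (by fun_prop)
      (StarSubalgebra.isClosed_topologicalClosure _)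
  exact closure_minimal h hc hx

variable {φ} in
/-- The endomorphism `x ↦ w x w⋆` of `C*(P)`, for an isometry `w` that conjugates `P` into `P`. -/
def conjEnd (w : EndoAlgebra φ) (hw : star w * w = 1)
    (hP : ∀ x ∈ projections φ, w * x * star w ∈ projections φ) :
    diagonal φ →⋆ₙₐ[ℂ] diagonal φ where
  toFun x := ⟨w * x * star w, conj_mem hw hP x.2⟩
  map_smul' c x := Subtype.ext (by simp)
  map_zero' := Subtype.ext (by simp)
  map_add' x y := Subtype.ext (by simp [mul_add, add_mul])
  map_mul' x y := Subtype.ext (by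
    calc w * ((x : EndoAlgebra φ) * y) * star w = w * x * 1 * y * star w := by
          simp only [mul_one, mul_assoc]
      _ = (w * x * star w) * (w * y * star w) := by rw [← hw]; simp only [mul_assoc])
  map_star' x := Subtype.ext (by simp [mul_assoc])

theorem u_conj_projections (g : G) (x : EndoAlgebra φ) (hx : x ∈ projections φ) :
    u φ g * x * star (u φ g) ∈ projections φ := by
  obtain ⟨h, n, rfl⟩ := hx
  refine ⟨g * h, n, ?_⟩
  rw [star_u, mul_inv_rev, ← u_mul_u, ← u_mul_u]
  simp only [mul_assoc]

theorem s_conj_projections (n : ℕ) (x : EndoAlgebra φ) (hx : x ∈ projections φ) :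
    s φ ^ n * x * star (s φ ^ n) ∈ projections φ := by
  obtain ⟨g, m, rfl⟩ := hx
  refine ⟨φ^[n] g, n + m, ?_⟩
  have h := congrArg star (s_pow_mul_u φ n g)
  rw [star_mul, star_mul, star_u, star_u] at h
  calc s φ ^ n * (u φ g * s φ ^ m * star (s φ) ^ m * u φ g⁻¹) * star (s φ ^ n)
      = (s φ ^ n * u φ g) * s φ ^ m * star (s φ) ^ m * (u φ g⁻¹ * star (s φ ^ n)) := by
        simp only [mul_assoc]
    _ = u φ (φ^[n] g) * (s φ ^ n * s φ ^ m) * (star (s φ) ^ m * star (s φ) ^ n)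
          * u φ (φ^[n] g)⁻¹ := by
        rw [h, s_pow_mul_u, star_pow]; simp only [mul_assoc]
    _ = _ := by rw [← pow_add, ← pow_add, add_comm m n]

/-- The action `ω` of `G` on `C*(P)`, `ω_g(x) = u_g x u_g⋆ = u_g x u_{g⁻¹}`. As a homomorphism from
a group to the monoid of endomorphisms it takes its values in the automorphisms. -/
def omega : G →* (diagonal φ →⋆ₙₐ[ℂ] diagonal φ) where
  toFun g := conjEnd (u φ g) (star_u_mul_u φ g) (u_conj_projections φ g)
  map_one' := by
    ext x
    change u φ 1 * (x : EndoAlgebra φ) * star (u φ 1) = x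
    simp [u_one]
  map_mul' g h := by
    ext x
    change u φ (g * h) * (x : EndoAlgebra φ) * star (u φ (g * h))
      = u φ g * (u φ h * x * star (u φ h)) * star (u φ g)
    rw [← u_mul_u, star_mul]
    simp only [mul_assoc]

/-- The endomorphism `x ↦ sⁿ x s⋆ⁿ` of `C*(P)`. -/
def shift (n : ℕ) : diagonal φ →⋆ₙₐ[ℂ] diagonal φ :=
  conjEnd (s φ ^ n) (star_s_pow_mul φ n) (s_conj_projections φ n)

end EndoAlgebra

end Endo

/-! ### Crossed products by semigroups of endomorphisms -/

/-- The generators of a crossed product: the elements of the algebra and those of the semigroup. -/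
inductive CrossedGen (A : Type u) (S : Type v) : Type (max u v)
  | alg (a : A)
  | sg (t : S)

section Crossed

variable {A : Type u} [CStarAlgebra A] {S : Type v} [Monoid S]

/-- The relations of the crossed product `A ⋊_α S`: those which say that `alg` is a unital
`*`-homomorphism and `sg` a unital semigroup homomorphism to the isometries, and the covariance
relation `sg t * alg a * (sg t)⋆ = alg (α_t a)`. -/
inductive CrossedRel (α : S →* (A →⋆ₙₐ[ℂ] A)) :
    FreeStar (CrossedGen A S) → FreeStar (CrossedGen A S) → Prop
  | alg_one : CrossedRel α (.gen (.alg 1)) 1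
  | alg_add (a b : A) : CrossedRel α (.gen (.alg (a + b))) (.gen (.alg a) + .gen (.alg b))
  | alg_smul (c : ℂ) (a : A) : CrossedRel α (.gen (.alg (c • a))) (c • .gen (.alg a))
  | alg_mul (a b : A) : CrossedRel α (.gen (.alg (a * b))) (.gen (.alg a) * .gen (.alg b))
  | alg_star (a : A) : CrossedRel α (.gen (.alg (star a))) (star (.gen (.alg a)))
  | sg_one : CrossedRel α (.gen (.sg 1)) 1
  | sg_mul (t r : S) : CrossedRel α (.gen (.sg (t * r))) (.gen (.sg t) * .gen (.sg r))
  | sg_isometry (t : S) : CrossedRel α (star (.gen (.sg t)) * .gen (.sg t)) 1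
  | covariance (t : S) (a : A) :
      CrossedRel α (.gen (.sg t) * .gen (.alg a) * star (.gen (.sg t))) (.gen (.alg (α t a)))

/-- The norm bounds for the generators of a crossed product, which are no restriction, since
`*`-homomorphisms of C*-algebras are contractive and isometries have norm at most `1`. -/
def crossedBound : CrossedGen A S → ℝ≥0
  | .alg a => ‖a‖₊
  | .sg _ => 1

/-- The crossed product `A ⋊_α S` of a unital C*-algebra by an action of a monoid by (not
necessarily unital) `*`-endomorphisms: the universal C*-algebra for covariant representations,
which consist of a unital `*`-homomorphism of `A` and a representation of `S` by isometries.
If `S` is a group, the isometries are unitaries, and this is the full group crossed product. -/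
abbrev CrossedProduct (α : S →* (A →⋆ₙₐ[ℂ] A)) : Type (max u v) :=
  (CStarPresentation.mk crossedBound (CrossedRel α)).Universal

namespace CrossedProduct

open CStarPresentation

variable (α : S →* (A →⋆ₙₐ[ℂ] A))

/-- The canonical map of `A` to the crossed product. -/
def ι (a : A) : CrossedProduct α := Universal.gen _ (.alg a)

/-- The canonical isometry (a unitary, if `S` is a group) of an element of `S`. -/
def δ (t : S) : CrossedProduct α := Universal.gen _ (.sg t)

end CrossedProduct

end Crossed

namespace EndoAlgebra

variable {G : Type u} [Group G] (φ : G →* G) [φ.range.FiniteIndex]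

/-- `τ` is an action of the semigroup `ℕ` on `C*(P) ⋊_ω G` by endomorphisms such that
`τ_n(a δ_g) = (sⁿ a s⋆ⁿ) δ_{φⁿ(g)}`. -/
def IsShiftAction
    (τ : Multiplicative ℕ →* (CrossedProduct (omega φ) →⋆ₙₐ[ℂ] CrossedProduct (omega φ))) : Prop :=
  ∀ (n : ℕ) (a : diagonal φ) (g : G),
    τ (Multiplicative.ofAdd n) (CrossedProduct.ι (omega φ) a * CrossedProduct.δ (omega φ) g)
      = CrossedProduct.ι (omega φ) (shift φ n a) * CrossedProduct.δ (omega φ) (φ^[n] g)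

end EndoAlgebra

end

/-! All three algebras are universal, so homomorphisms out of them amount to relations checked on
generators, and two of them agree once they agree on generators.

Existence of `τ` is the delicate point: `τ_n` sends `1` to the projection `sⁿ s⋆ⁿ`, so a unital
universal property does not produce it. The remedy (`CrossedProduct.map`) is to take the unital lift
of the free `*`-algebra that sends `a` to `sⁿ a s⋆ⁿ` and `g` to `φⁿ(g)`, and multiply it by `p =
ι(sⁿ s⋆ⁿ)`. The lift need not respect the relation that `ι` is unital, but its image commutes with
`p` (`commute_mapLift`), so the compression is a `*`-homomorphism, and it respects every relation.
Uniqueness holds because the products `a δ_g` include `1` and all generators.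

For the isomorphism, `a δ_g ↦ a u_g` and `n ↦ sⁿ` are covariant for `τ` (`s_pow_conj_ofCrossed`),
which gives a map to `𝕌[φ]`. Conversely, `δ_g` and the isometry of `1 ∈ ℕ` satisfy the relations of
`𝕌[φ]` (`sImage_mul_uImage`, `sum_uImage_conj`). That the two maps are inverse needs one further
fact: the second carries `C*(P)` to its canonical copy (`toDoubleCrossed_diagonal`). This is checked
on `P`, where it reduces to the range projections of the powers of the isometry being `τ_n(1)`
(`sImage_pow_mul_star`). -/

noncomputable section

universe w x

/-! ### Universal property of the free `*`-algebra. -/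

namespace FreeStar

variable {X : Type u} {B : Type v} [Ring B] [Algebra ℂ B] [StarRing B]

/-- The universal property of the free unital `*`-algebra, as an algebra homomorphism. -/
def liftAlg (f : X → B) : FreeStar X →ₐ[ℂ] B :=
  MonoidAlgebra.lift ℂ B (FreeMonoid (X × Bool))
    (FreeMonoid.lift fun p : X × Bool => if p.2 then f p.1 else star (f p.1))

theorem liftAlg_letter (f : X → B) (x : X) (b : Bool) :
    liftAlg f (word (FreeMonoid.of (x, b))) = if b then f x else star (f x) :=
  (MonoidAlgebra.lift_of _ _).trans (FreeMonoid.lift_eval_of _ _)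

/-- The universal property of the free unital `*`-algebra. -/
def lift [StarModule ℂ B] (f : X → B) : FreeStar X →⋆ₐ[ℂ] B where
  __ := liftAlg f
  map_star' a := by
    change liftAlg f (star a) = star (liftAlg f a)
    induction a using FreeStar.induction with
    | hc c => rw [star_algebraMap, AlgHom.commutes, AlgHom.commutes, ← algebraMap_star_comm]; rfl
    | hl x b => rw [star_letter, liftAlg_letter, liftAlg_letter]; cases b <;> simp
    | ha a b h h' => rw [star_add, map_add, map_add, star_add, h, h']
    | hm a b h h' => rw [star_mul, map_mul, map_mul, star_mul, h, h']

@[simp]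
theorem lift_gen [StarModule ℂ B] (f : X → B) (x : X) : lift f (gen x) = f x :=
  liftAlg_letter f x true

end FreeStar

/-! ### Universal property of presented C*-algebras, for unital and non-unital homomorphisms. -/

namespace CStarPresentation.Universal

open UniformSpace

variable {X : Type u} {R : CStarPresentation X} {B : Type v} [CStarAlgebra B]

/-- The C*-seminorm that a `*`-homomorphism to a C*-algebra induces on the free `*`-algebra. -/
def pullbackSeminorm (π : FreeStar X →⋆ₙₐ[ℂ] B) : Seminorm ℂ (FreeStar X) :=
  (normSeminorm ℂ B).comp (π : FreeStar X →ₗ[ℂ] B)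

theorem pullbackSeminorm_apply (π : FreeStar X →⋆ₙₐ[ℂ] B) (a : FreeStar X) :
    pullbackSeminorm π a = ‖π a‖ := rfl

/-- A not necessarily unital `*`-homomorphism of the free `*`-algebra that respects the bounds and
the relations. -/
structure IsCompatible (R : CStarPresentation X) (π : FreeStar X →⋆ₙₐ[ℂ] B) : Prop where
  norm_gen_le : ∀ x, ‖π (.gen x)‖ ≤ R.bound x
  map_rel : ∀ a b, R.rel a b → π a = π b

variable {π : FreeStar X →⋆ₙₐ[ℂ] B}

/-- The C*-identity and submultiplicativity are inherited from the norm of `B`; this does not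
require `π` to be unital. -/
theorem IsCompatible.isAdmissible (hπ : IsCompatible R π) : R.IsAdmissible (pullbackSeminorm π) where
  mul_le a b := by simpa only [pullbackSeminorm_apply, map_mul] using norm_mul_le (π a) (π b)
  star_mul_self a := by
    simpa only [pullbackSeminorm_apply, map_mul, map_star] using CStarRing.norm_star_mul_self
  gen_le := hπ.norm_gen_le
  rel_eq a b h := by
    rw [pullbackSeminorm_apply, map_sub, hπ.map_rel a b h, sub_self, norm_zero]

/-- The universal norm dominates every admissible seminorm, so `π` is contractive and passes to the
completion. -/
theorem IsCompatible.uniformContinuous (hπ : IsCompatible R π) :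
    UniformContinuous (fun a : R.Pre => π a) :=
  (AddMonoidHomClass.lipschitz_of_bound (show R.Pre →ₗ[ℂ] B from (π : FreeStar X →ₗ[ℂ] B)) 1
    fun a => (hπ.isAdmissible.le_norm a).trans (one_mul _).ge).uniformContinuous

/-- The extension of a compatible `*`-homomorphism to the universal C*-algebra, as a function. -/
def extendFun (R : CStarPresentation X) (π : FreeStar X →⋆ₙₐ[ℂ] B) : R.Universal → B :=
  (Completion.extension (fun a : R.Pre => π a) : Completion R.Pre → B)

theorem continuous_extendFun : Continuous (extendFun R π) :=
  Completion.continuous_extension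

theorem extendFun_coe (hπ : IsCompatible R π) (a : FreeStar X) :
    extendFun R π (coe R a) = π a :=
  Completion.extension_coe hπ.uniformContinuous a

instance : ContinuousStar R.Universal := ⟨continuous_star' R⟩

/-- The extension of a compatible `*`-homomorphism to the universal C*-algebra. -/
def extend (π : FreeStar X →⋆ₙₐ[ℂ] B) (hπ : IsCompatible R π) : R.Universal →⋆ₙₐ[ℂ] B where
  toFun := extendFun R π
  map_smul' c x := by
    have hc := continuous_extendFun (R := R) (π := π)
    induction x using induction with
    | hp => exact isClosed_eq (hc.comp (continuous_const_smul c)) (hc.const_smul c)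
    | h a => rw [← map_smul, extendFun_coe hπ, extendFun_coe hπ, map_smul]; rfl
  map_zero' := by rw [← map_zero (coe R), extendFun_coe hπ, map_zero]
  map_add' x y := by
    have hc := continuous_extendFun (R := R) (π := π)
    induction x using induction with
    | hp => exact isClosed_eq (by fun_prop) (by fun_prop)
    | h a =>
      induction y using induction with
      | hp => exact isClosed_eq (by fun_prop) (by fun_prop)
      | h b => simp only [← map_add, extendFun_coe hπ]
  map_mul' x y := by
    have hc := continuous_extendFun (R := R) (π := π)
    induction x using induction with
    | hp => exact isClosed_eq (by fun_prop) (by fun_prop)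
    | h a =>
      induction y using induction with
      | hp => exact isClosed_eq (by fun_prop) (by fun_prop)
      | h b => simp only [← map_mul, extendFun_coe hπ]
  map_star' x := by
    have hc := continuous_extendFun (R := R) (π := π)
    induction x using induction with
    | hp => exact isClosed_eq (by fun_prop) (by fun_prop)
    | h a => rw [star_coe, extendFun_coe hπ, extendFun_coe hπ, map_star]

theorem extend_coe (hπ : IsCompatible R π) (a : FreeStar X) : extend π hπ (coe R a) = π a :=
  extendFun_coe hπ a

theorem extend_gen (hπ : IsCompatible R π) (x : X) : extend π hπ (gen R x) = π (.gen x) :=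
  extendFun_coe hπ _

theorem isCompatible_lift {f : X → B} (hf : ∀ x, ‖f x‖ ≤ R.bound x)
    (h : ∀ a b, R.rel a b → FreeStar.lift f a = FreeStar.lift f b) :
    IsCompatible R (FreeStar.lift f : FreeStar X →⋆ₙₐ[ℂ] B) :=
  ⟨fun x => (congrArg norm (FreeStar.lift_gen f x)).trans_le (hf x), h⟩

/-- A unital `*`-homomorphism of the universal C*-algebra, given by its values on the generators. -/
def desc (f : X → B) (hf : ∀ x, ‖f x‖ ≤ R.bound x)
    (h : ∀ a b, R.rel a b → FreeStar.lift f a = FreeStar.lift f b) : R.Universal →⋆ₐ[ℂ] B where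
  __ := extend (R := R) (FreeStar.lift f : FreeStar X →⋆ₙₐ[ℂ] B) (isCompatible_lift hf h)
  map_one' := by
    rw [← map_one (coe R)]
    exact (extendFun_coe (isCompatible_lift hf h) _).trans (map_one (FreeStar.lift f))
  commutes' c := by
    rw [← (coe R).commutes]
    exact (extendFun_coe (isCompatible_lift hf h) _).trans ((FreeStar.lift f).commutes c)

theorem desc_gen (f : X → B) (hf : ∀ x, ‖f x‖ ≤ R.bound x)
    (h : ∀ a b, R.rel a b → FreeStar.lift f a = FreeStar.lift f b) (x : X) :
    desc f hf h (gen R x) = f x :=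
  (extend_gen (isCompatible_lift hf h) _).trans (FreeStar.lift_gen f x)

theorem continuous_nonUnitalStarAlgHom {A : Type u} [CStarAlgebra A] (f : A →⋆ₙₐ[ℂ] B) :
    Continuous f :=
  AddMonoidHomClass.continuous_of_bound f 1 fun a =>
    (NonUnitalStarAlgHom.norm_apply_le f a).trans (one_mul _).ge

/-- Homomorphisms of C*-algebras are contractive, so density reduces this to `*`-polynomials.
Agreement at `1` is what settles the scalars, since a non-unital homomorphism may send `1` to any
projection. -/
theorem nonUnitalHom_ext {f g : R.Universal →⋆ₙₐ[ℂ] B} (h1 : f 1 = g 1)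
    (h : ∀ x, f (gen R x) = g (gen R x)) : f = g := by
  ext x
  induction x using induction with
  | hp => exact isClosed_eq (continuous_nonUnitalStarAlgHom f) (continuous_nonUnitalStarAlgHom g)
  | h a =>
    induction a using FreeStar.induction with
    | hc c => rw [AlgHom.commutes, Algebra.algebraMap_eq_smul_one, map_smul, map_smul, h1]
    | hl x b =>
      cases b with
      | true => exact h x
      | false =>
        have h' := congrArg star (h x)
        rwa [← map_star, ← map_star, gen, star_coe, FreeStar.gen, FreeStar.star_letter] at h'
    | ha a b h h' => rw [map_add, map_add, map_add, h, h']
    | hm a b h h' => rw [map_mul, map_mul, map_mul, h, h']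

theorem hom_ext {f g : R.Universal →⋆ₐ[ℂ] B} (h : ∀ x, f (gen R x) = g (gen R x)) : f = g := by
  have h' : (f : R.Universal →⋆ₙₐ[ℂ] B) = g :=
    nonUnitalHom_ext ((map_one f).trans (map_one g).symm) h
  ext x
  exact DFunLike.congr_fun h' x

end CStarPresentation.Universal

/-! ### Relations in a crossed product, and covariant representations. -/

namespace CrossedProduct

open CStarPresentation

variable {A : Type u} [CStarAlgebra A] {S : Type v} [Monoid S] (α : S →* (A →⋆ₙₐ[ℂ] A))

/-- The canonical `*`-homomorphism of `A` to the crossed product. -/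
def ιHom : A →⋆ₐ[ℂ] CrossedProduct α where
  toFun := ι α
  map_one' := (Universal.coe_eq_of_rel (.mk crossedBound (CrossedRel α)) .alg_one).trans (map_one _)
  map_mul' a b :=
    (Universal.coe_eq_of_rel (.mk crossedBound (CrossedRel α)) (.alg_mul a b)).trans (map_mul _ _ _)
  map_zero' := by
    -- No relation says that `0` goes to `0`; homogeneity for the scalar `0` does.
    have h := (Universal.coe_eq_of_rel (.mk crossedBound (CrossedRel α)) (.alg_smul 0 0)).trans
      (map_smul _ _ _)
    rwa [zero_smul, zero_smul] at h
  map_add' a b :=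
    (Universal.coe_eq_of_rel (.mk crossedBound (CrossedRel α)) (.alg_add a b)).trans (map_add _ _ _)
  commutes' c := by
    have h := (Universal.coe_eq_of_rel (.mk crossedBound (CrossedRel α)) (.alg_smul c 1)).trans
      (map_smul _ _ _)
    have h1 := (Universal.coe_eq_of_rel (.mk crossedBound (CrossedRel α)) .alg_one).trans (map_one _)
    rw [h1] at h
    rwa [Algebra.algebraMap_eq_smul_one, Algebra.algebraMap_eq_smul_one]
  map_star' a :=
    (Universal.coe_eq_of_rel (.mk crossedBound (CrossedRel α)) (.alg_star a)).trans
      (Universal.star_coe _ _).symm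

/-- The canonical representation of `S` by isometries in the crossed product. -/
def δHom : S →* CrossedProduct α where
  toFun := δ α
  map_one' := (Universal.coe_eq_of_rel (.mk crossedBound (CrossedRel α)) .sg_one).trans (map_one _)
  map_mul' t r :=
    (Universal.coe_eq_of_rel (.mk crossedBound (CrossedRel α)) (.sg_mul t r)).trans (map_mul _ _ _)

theorem ι_one : ι α 1 = 1 := map_one (ιHom α)

theorem ι_mul (a b : A) : ι α (a * b) = ι α a * ι α b := map_mul (ιHom α) a b

theorem ι_add (a b : A) : ι α (a + b) = ι α a + ι α b := map_add (ιHom α) a b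

theorem ι_smul (c : ℂ) (a : A) : ι α (c • a) = c • ι α a := map_smul (ιHom α) c a

theorem ι_star (a : A) : ι α (star a) = star (ι α a) := map_star (ιHom α) a

theorem δ_one : δ α 1 = 1 := map_one (δHom α)

theorem δ_mul (t r : S) : δ α (t * r) = δ α t * δ α r := map_mul (δHom α) t r

theorem star_δ_mul_δ (t : S) : star (δ α t) * δ α t = 1 := by
  have h := Universal.coe_eq_of_rel (.mk crossedBound (CrossedRel α)) (.sg_isometry t)
  rwa [map_mul, map_one, ← Universal.star_coe] at h

theorem covariance (t : S) (a : A) : δ α t * ι α a * star (δ α t) = ι α (α t a) := by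
  have h := Universal.coe_eq_of_rel (.mk crossedBound (CrossedRel α)) (.covariance t a)
  rwa [map_mul, map_mul, ← Universal.star_coe] at h

theorem δ_mul_ι (t : S) (a : A) : δ α t * ι α a = ι α (α t a) * δ α t := by
  rw [← covariance, mul_assoc, star_δ_mul_δ, mul_one]

/-- The C*-identity gives norm exactly `1`, except in the zero algebra, where `1` has norm `0`. -/
theorem norm_le_one_of_isometry {B : Type w} [CStarAlgebra B] {x : B} (hx : star x * x = 1) :
    ‖x‖ ≤ 1 := by
  rcases subsingleton_or_nontrivial B with _ | _
  · simp [Subsingleton.elim x 0]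
  · have h := CStarRing.norm_star_mul_self (x := x)
    rw [hx, CStarRing.norm_one] at h
    nlinarith [norm_nonneg x]

variable {α}

/-- Setting `a = 1` or `t = 1` recovers all generators, and setting both recovers the unit, so
unitality need not be assumed. -/
theorem nonUnitalHom_ext {B : Type w} [CStarAlgebra B] {f g : CrossedProduct α →⋆ₙₐ[ℂ] B}
    (h : ∀ a t, f (ι α a * δ α t) = g (ι α a * δ α t)) : f = g := by
  refine Universal.nonUnitalHom_ext ?_ fun x => ?_
  · simpa only [ι_one, δ_one, mul_one] using h 1 1
  · cases x with
    | alg a =>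
      have h' := h a 1
      rwa [δ_one, mul_one] at h'
    | sg t =>
      have h' := h 1 t
      rwa [ι_one, one_mul] at h'

theorem hom_ext {B : Type w} [CStarAlgebra B] {f g : CrossedProduct α →⋆ₐ[ℂ] B}
    (hι : ∀ a, f (ι α a) = g (ι α a)) (hδ : ∀ t, f (δ α t) = g (δ α t)) : f = g :=
  Universal.hom_ext fun x => by
    cases x with
    | alg a => exact hι a
    | sg t => exact hδ t

/-- The values on the generators of the crossed product of a pair of maps. -/
def genMap {B : Type w} (θ : A → B) (σ : S → B) : CrossedGen A S → B
  | .alg a => θ a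
  | .sg t => σ t

/-- The integrated form of a covariant representation. -/
def desc {B : Type w} [CStarAlgebra B] (θ : A →⋆ₐ[ℂ] B) (σ : S →* B)
    (hσ : ∀ t, star (σ t) * σ t = 1) (h : ∀ t a, σ t * θ a * star (σ t) = θ (α t a)) :
    CrossedProduct α →⋆ₐ[ℂ] B :=
  Universal.desc (genMap θ σ)
    (fun x => by
      cases x with
      | alg a => exact NonUnitalStarAlgHom.norm_apply_le θ a
      | sg t => exact norm_le_one_of_isometry (hσ t))
    (fun a b hab => by
      cases hab <;>
        simp only [map_one, map_add, map_smul, map_mul, map_star, FreeStar.lift_gen, genMap, hσ, h])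

section desc

variable {B : Type w} [CStarAlgebra B] (θ : A →⋆ₐ[ℂ] B) (σ : S →* B)
    (hσ : ∀ t, star (σ t) * σ t = 1) (h : ∀ t a, σ t * θ a * star (σ t) = θ (α t a))

theorem desc_ι (a : A) : desc θ σ hσ h (ι α a) = θ a := Universal.desc_gen _ _ _ _

theorem desc_δ (t : S) : desc θ σ hσ h (δ α t) = σ t := Universal.desc_gen _ _ _ _

end desc

/-! ### Functoriality of crossed products for non-unital equivariant homomorphisms. -/

section map

variable {B : Type w} [CStarAlgebra B] {T : Type x} [Monoid T] {β : T →* (B →⋆ₙₐ[ℂ] B)}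

/-- The homomorphism of the free `*`-algebra to `B ⋊_β T` that extends `θ` and `σ`. -/
def mapLift (β : T →* (B →⋆ₙₐ[ℂ] B)) (θ : A →⋆ₙₐ[ℂ] B) (σ : S →* T) :
    FreeStar (CrossedGen A S) →⋆ₐ[ℂ] CrossedProduct β :=
  FreeStar.lift (genMap (fun a => ι β (θ a)) fun t => δ β (σ t))

/-- The projection `ι (θ 1)` is a unit for every `ι (θ a)`. It commutes with `δ (σ t)` because
equivariance and `α t 1 = 1` make `θ 1` a fixed point of `β (σ t)`. Adjoints follow as it is
self-adjoint. -/
theorem commute_mapLift (θ : A →⋆ₙₐ[ℂ] B) (σ : S →* T) (hα : ∀ t, α t 1 = 1)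
    (h : ∀ t a, β (σ t) (θ a) = θ (α t a)) (x : FreeStar (CrossedGen A S)) :
    Commute (ι β (θ 1)) (mapLift β θ σ x) := by
  have hsa : star (ι β (θ 1)) = ι β (θ 1) := by rw [← ι_star, ← map_star, star_one]
  have hgen : ∀ x, Commute (ι β (θ 1)) (mapLift β θ σ (.gen x)) := fun x => by
    rw [mapLift, FreeStar.lift_gen]
    cases x with
    | alg a =>
      change ι β (θ 1) * ι β (θ a) = ι β (θ a) * ι β (θ 1)
      simp only [← ι_mul, ← map_mul, one_mul, mul_one]
    | sg t =>
      change ι β (θ 1) * δ β (σ t) = δ β (σ t) * ι β (θ 1)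
      rw [δ_mul_ι, h, hα]
  induction x using FreeStar.induction with
  | hc c => rw [AlgHomClass.commutes]; exact Algebra.commute_algebraMap_right c _
  | hl x b =>
    cases b with
    | true => exact hgen x
    | false =>
      have h' := (hgen x).star_star
      rwa [hsa, ← map_star, FreeStar.gen, FreeStar.star_letter] at h'
  | ha a b h h' => rw [map_add]; exact h.add_right h'
  | hm a b h h' => rw [map_mul]; exact h.mul_right h'

/-- The compression of `mapLift` to the projection `ι (θ 1)`. -/
def mapCompress (θ : A →⋆ₙₐ[ℂ] B) (σ : S →* T) (hα : ∀ t, α t 1 = 1)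
    (h : ∀ t a, β (σ t) (θ a) = θ (α t a)) :
    FreeStar (CrossedGen A S) →⋆ₙₐ[ℂ] CrossedProduct β where
  toFun x := ι β (θ 1) * mapLift β θ σ x
  map_smul' c x := by simp
  map_zero' := by simp
  map_add' x y := by simp [mul_add]
  map_mul' x y := by
    have hp : ι β (θ 1) * ι β (θ 1) = ι β (θ 1) := by rw [← ι_mul, ← map_mul, one_mul]
    have hc := commute_mapLift θ σ hα h x
    calc ι β (θ 1) * mapLift β θ σ (x * y)
        = ι β (θ 1) * (ι β (θ 1) * mapLift β θ σ x) * mapLift β θ σ y := by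
          rw [map_mul, ← mul_assoc, ← mul_assoc, hp]
      _ = ι β (θ 1) * (mapLift β θ σ x * ι β (θ 1)) * mapLift β θ σ y := by rw [hc.eq]
      _ = _ := by simp only [mul_assoc]
  map_star' x := by
    have hsa : star (ι β (θ 1)) = ι β (θ 1) := by rw [← ι_star, ← map_star, star_one]
    rw [star_mul, hsa, map_star, ← map_star, (commute_mapLift θ σ hα h (star x)).eq]

/-- The homomorphism of crossed products that an equivariant homomorphism `θ`, not necessarily
unital, induces. -/
def map (θ : A →⋆ₙₐ[ℂ] B) (σ : S →* T) (hα : ∀ t, α t 1 = 1)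
    (h : ∀ t a, β (σ t) (θ a) = θ (α t a)) : CrossedProduct α →⋆ₙₐ[ℂ] CrossedProduct β :=
  Universal.extend (mapCompress θ σ hα h)
    { norm_gen_le x := by
        change ‖ι β (θ 1) * mapLift β θ σ (.gen x)‖ ≤ _
        rw [mapLift, FreeStar.lift_gen]
        cases x with
        | alg a =>
          change ‖ι β (θ 1) * ι β (θ a)‖ ≤ ‖a‖
          rw [← ι_mul, ← map_mul, one_mul]
          exact (NonUnitalStarAlgHom.norm_apply_le (ιHom β) _).trans
            (NonUnitalStarAlgHom.norm_apply_le θ a)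
        | sg t =>
          change ‖ι β (θ 1) * δ β (σ t)‖ ≤ 1
          -- Since `A` may be zero, `‖1‖ ≤ 1` is taken from `star 1 * 1 = 1`.
          have hp : ‖ι β (θ 1)‖ ≤ 1 :=
            ((NonUnitalStarAlgHom.norm_apply_le (ιHom β) _).trans
            (NonUnitalStarAlgHom.norm_apply_le θ 1)).trans (norm_le_one_of_isometry (by simp))
          exact (norm_mul_le _ _).trans (mul_le_one₀ hp (norm_nonneg _)
            (norm_le_one_of_isometry (star_δ_mul_δ β _)))
      map_rel a b hab := by
        change ι β (θ 1) * mapLift β θ σ a = ι β (θ 1) * mapLift β θ σ b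
        cases hab <;>
          simp only [mapLift, map_mul, map_star, map_add, map_smul, map_one, FreeStar.lift_gen,
            genMap, δ_one, δ_mul, star_δ_mul_δ, covariance, h, ι_mul, ι_star, ι_add, ι_smul, mul_one]
        -- Only unitality of `ι` is left. After compression it says that `ι (θ 1)` is idempotent.
        rw [← ι_mul, ← map_mul, one_mul] }

/-- The compressing projection is absorbed by `ι (θ a)`, so it is invisible on these products. -/
theorem map_apply_mul (θ : A →⋆ₙₐ[ℂ] B) (σ : S →* T) (hα : ∀ t, α t 1 = 1)
    (h : ∀ t a, β (σ t) (θ a) = θ (α t a)) (a : A) (t : S) :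
    map θ σ hα h (ι α a * δ α t) = ι β (θ a) * δ β (σ t) := by
  have h1 : ι α a * δ α t = Universal.coe _ (.gen (.alg a) * .gen (.sg t)) := (map_mul _ _ _).symm
  rw [h1, map, Universal.extend_coe]
  change ι β (θ 1) * mapLift β θ σ _ = _
  rw [map_mul, mapLift, FreeStar.lift_gen, FreeStar.lift_gen, ← mul_assoc]
  change ι β (θ 1) * ι β (θ a) * δ β (σ t) = _
  rw [← ι_mul, ← map_mul, one_mul]

end map

end CrossedProduct

/-! ### The action of `ℕ` on `C*(P) ⋊_ω G`. -/

namespace EndoAlgebra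

attribute [local instance] Subgroup.fintypeQuotientOfFiniteIndex

open CStarPresentation

variable {G : Type u} [Group G] (φ : G →* G) [φ.range.FiniteIndex]

theorem sum_projections_eq_one :
    ∑ q : G ⧸ φ.range, u φ q.out * s φ * star (s φ) * u φ (q.out)⁻¹ = 1 := by
  have h := Universal.coe_eq_of_rel (.mk (fun _ => 1) (EndoRel φ)) .sum_eq_one
  rw [map_sum, map_one] at h
  rw [← h]
  refine Finset.sum_congr rfl fun q _ => ?_
  rw [map_mul, map_mul, map_mul, ← Universal.star_coe]
  rfl

/-- The iterate of an endomorphism of a group, as a homomorphism. -/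
def iterateHom (φ : G →* G) (n : ℕ) : G →* G where
  toFun := φ^[n]
  map_one' := iterate_map_one φ n
  map_mul' := iterate_map_mul φ n

theorem omega_apply_coe (g : G) (a : diagonal φ) :
    (omega φ g a : EndoAlgebra φ) = u φ g * a * star (u φ g) := rfl

theorem shift_apply_coe (n : ℕ) (a : diagonal φ) :
    (shift φ n a : EndoAlgebra φ) = s φ ^ n * a * star (s φ ^ n) := rfl

theorem omega_one (g : G) : omega φ g 1 = 1 := Subtype.ext (by
  rw [omega_apply_coe, OneMemClass.coe_one, mul_one, u_mul_star_u])

/-- This is `sⁿ u_g = u_{φⁿ(g)} sⁿ` together with its adjoint; it is the equivariance that lets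
`shift φ n` induce a map of crossed products. -/
theorem omega_shift (n : ℕ) (g : G) (a : diagonal φ) :
    omega φ (iterateHom φ n g) (shift φ n a) = shift φ n (omega φ g a) := Subtype.ext (by
  simp only [omega_apply_coe, shift_apply_coe]
  calc u φ (φ^[n] g) * (s φ ^ n * a * star (s φ ^ n)) * star (u φ (φ^[n] g))
      = (u φ (φ^[n] g) * s φ ^ n) * a * star (u φ (φ^[n] g) * s φ ^ n) := by
        simp only [star_mul, mul_assoc]
    _ = _ := by rw [← s_pow_mul_u]; simp only [star_mul, mul_assoc])

theorem shift_zero (a : diagonal φ) : shift φ 0 a = a := Subtype.ext (by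
  simp [shift_apply_coe])

theorem shift_add (m n : ℕ) (a : diagonal φ) : shift φ (m + n) a = shift φ m (shift φ n a) :=
  Subtype.ext (by simp only [shift_apply_coe, pow_add, star_mul, mul_assoc])

/-- The endomorphism `a δ_g ↦ (sⁿ a s⋆ⁿ) δ_{φⁿ(g)}` of `C*(P) ⋊_ω G`. -/
def shiftCrossed (n : ℕ) : CrossedProduct (omega φ) →⋆ₙₐ[ℂ] CrossedProduct (omega φ) :=
  CrossedProduct.map (shift φ n) (iterateHom φ n) (omega_one φ) (omega_shift φ n)

theorem shiftCrossed_apply (n : ℕ) (a : diagonal φ) (g : G) :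
    shiftCrossed φ n (CrossedProduct.ι (omega φ) a * CrossedProduct.δ (omega φ) g)
      = CrossedProduct.ι (omega φ) (shift φ n a) * CrossedProduct.δ (omega φ) (φ^[n] g) :=
  CrossedProduct.map_apply_mul _ _ _ _ _ _

/-- The action of `ℕ` on `C*(P) ⋊_ω G` by the endomorphisms `shiftCrossed φ n`. -/
def shiftAction :
    Multiplicative ℕ →* (CrossedProduct (omega φ) →⋆ₙₐ[ℂ] CrossedProduct (omega φ)) where
  toFun n := shiftCrossed φ n.toAdd
  map_one' := CrossedProduct.nonUnitalHom_ext fun a g => by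
    rw [toAdd_one, shiftCrossed_apply, shift_zero]; rfl
  map_mul' m n := CrossedProduct.nonUnitalHom_ext fun a g => by
    change _ = shiftCrossed φ m.toAdd (shiftCrossed φ n.toAdd _)
    rw [toAdd_mul, shiftCrossed_apply, shiftCrossed_apply, shiftCrossed_apply, shift_add,
      Function.iterate_add_apply]

theorem isShiftAction_shiftAction : IsShiftAction φ (shiftAction φ) :=
  fun n a g => shiftCrossed_apply φ n a g

variable {φ} {τ : Multiplicative ℕ →* (CrossedProduct (omega φ) →⋆ₙₐ[ℂ] CrossedProduct (omega φ))}

theorem IsShiftAction.eq_shiftAction (hτ : IsShiftAction φ τ) : τ = shiftAction φ :=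
  MonoidHom.ext fun n => CrossedProduct.nonUnitalHom_ext fun a g =>
    (hτ n.toAdd a g).trans (shiftCrossed_apply φ _ a g).symm

/-! ### From the iterated crossed product to `𝕌[φ]`. -/

variable (φ) in
/-- The unitaries `u_g`, as a homomorphism. -/
def uHom : G →* EndoAlgebra φ where
  toFun := u φ
  map_one' := u_one φ
  map_mul' g h := (u_mul_u φ g h).symm

variable (φ) in
/-- The representation `a δ_g ↦ a u_g` of `C*(P) ⋊_ω G` in `𝕌[φ]`. -/
def ofCrossed : CrossedProduct (omega φ) →⋆ₐ[ℂ] EndoAlgebra φ :=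
  -- Covariance is the definition of `omega`.
  CrossedProduct.desc (diagonal φ).subtype (uHom φ) (star_u_mul_u φ) fun _ _ => rfl

theorem ofCrossed_ι (a : diagonal φ) : ofCrossed φ (CrossedProduct.ι (omega φ) a) = a :=
  CrossedProduct.desc_ι _ _ _ _ a

theorem ofCrossed_δ (g : G) : ofCrossed φ (CrossedProduct.δ (omega φ) g) = u φ g :=
  CrossedProduct.desc_δ _ _ _ _ g

/-- Conjugation by an isometry. -/
def conjIsometry {B : Type v} [CStarAlgebra B] (w : B) (hw : star w * w = 1) : B →⋆ₙₐ[ℂ] B where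
  toFun b := w * b * star w
  map_smul' c b := by simp
  map_zero' := by simp
  map_add' a b := by rw [mul_add, add_mul]
  map_mul' a b := by
    calc w * (a * b) * star w = w * a * 1 * b * star w := by simp only [mul_one, mul_assoc]
      _ = (w * a * star w) * (w * b * star w) := by rw [← hw]; simp only [mul_assoc]
  map_star' a := by simp [mul_assoc]

/-- Conjugation by an isometry is multiplicative, so both sides are `*`-homomorphisms in `b` and it
is enough to compare them on `a δ_g`. This is the covariance of `ofCrossed φ` with the powers of
`s`. -/
theorem s_pow_conj_ofCrossed (hτ : IsShiftAction φ τ) (n : ℕ) (b : CrossedProduct (omega φ)) :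
    s φ ^ n * ofCrossed φ b * star (s φ ^ n) = ofCrossed φ (τ (Multiplicative.ofAdd n) b) := by
  let F : CrossedProduct (omega φ) →⋆ₙₐ[ℂ] EndoAlgebra φ := ofCrossed φ
  have h : (conjIsometry (s φ ^ n) (star_s_pow_mul φ n)).comp F
      = F.comp (τ (Multiplicative.ofAdd n)) :=
    CrossedProduct.nonUnitalHom_ext fun a g => by
      change s φ ^ n * ofCrossed φ _ * star (s φ ^ n) = ofCrossed φ (τ (Multiplicative.ofAdd n) _)
      rw [hτ, map_mul, map_mul, ofCrossed_ι, ofCrossed_ι, ofCrossed_δ, ofCrossed_δ,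
        shift_apply_coe]
      -- The adjoint of the commutation rule, taken at `g⁻¹`.
      have hs : star (s φ ^ n) * u φ (φ^[n] g) = u φ g * star (s φ ^ n) := by
        have h := congrArg star (s_pow_mul_u φ n g⁻¹)
        rwa [star_mul, star_mul, star_u, star_u, iterate_map_inv, inv_inv, inv_inv, eq_comm] at h
      rw [mul_assoc _ _ (u φ _), hs]
      simp only [mul_assoc]
  exact DFunLike.congr_fun h b

/-- The powers of `s`, as a representation of `ℕ`. -/
def sHom (φ : G →* G) [φ.range.FiniteIndex] : Multiplicative ℕ →* EndoAlgebra φ :=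
  powersHom _ (s φ)

/-- The representation of `(C*(P) ⋊_ω G) ⋊_τ ℕ` in `𝕌[φ]`. -/
def ofDoubleCrossed (hτ : IsShiftAction φ τ) : CrossedProduct τ →⋆ₐ[ℂ] EndoAlgebra φ :=
  CrossedProduct.desc (ofCrossed φ) (sHom φ) (fun n => star_s_pow_mul φ n.toAdd)
    fun n b => s_pow_conj_ofCrossed hτ n.toAdd b

theorem ofDoubleCrossed_ι (hτ : IsShiftAction φ τ) (b : CrossedProduct (omega φ)) :
    ofDoubleCrossed hτ (CrossedProduct.ι τ b) = ofCrossed φ b :=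
  CrossedProduct.desc_ι _ _ _ _ b

theorem ofDoubleCrossed_δ (hτ : IsShiftAction φ τ) (n : ℕ) :
    ofDoubleCrossed hτ (CrossedProduct.δ τ (Multiplicative.ofAdd n)) = s φ ^ n :=
  CrossedProduct.desc_δ _ _ _ _ _

/-! ### From `𝕌[φ]` to the iterated crossed product. -/

section toDoubleCrossed

variable (τ)

/-- The image of `u_g` in `(C*(P) ⋊_ω G) ⋊_τ ℕ`. -/
def uImage (g : G) : CrossedProduct τ := CrossedProduct.ι τ (CrossedProduct.δ (omega φ) g)

/-- The image of `C*(P)` in `(C*(P) ⋊_ω G) ⋊_τ ℕ`. -/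
def diagonalImage : diagonal φ →⋆ₐ[ℂ] CrossedProduct τ :=
  (CrossedProduct.ιHom τ).comp (CrossedProduct.ιHom (omega φ))

/-- The image of `s` in `(C*(P) ⋊_ω G) ⋊_τ ℕ`. -/
def sImage : CrossedProduct τ := CrossedProduct.δ τ (Multiplicative.ofAdd 1)

theorem uImage_one : uImage τ 1 = 1 := by rw [uImage, CrossedProduct.δ_one, CrossedProduct.ι_one]

theorem uImage_mul (g h : G) : uImage τ g * uImage τ h = uImage τ (g * h) := by
  rw [uImage, uImage, uImage, CrossedProduct.δ_mul, CrossedProduct.ι_mul]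

theorem star_uImage_mul (g : G) : star (uImage τ g) * uImage τ g = 1 := by
  rw [uImage, ← CrossedProduct.ι_star, ← CrossedProduct.ι_mul, CrossedProduct.star_δ_mul_δ,
    CrossedProduct.ι_one]

theorem star_uImage (g : G) : star (uImage τ g) = uImage τ g⁻¹ := by
  calc star (uImage τ g) = star (uImage τ g) * (uImage τ g * uImage τ g⁻¹) := by
        rw [uImage_mul, mul_inv_cancel, uImage_one, mul_one]
    _ = uImage τ g⁻¹ := by rw [← mul_assoc, star_uImage_mul, one_mul]

theorem star_sImage_mul : star (sImage τ) * sImage τ = 1 := CrossedProduct.star_δ_mul_δ _ _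

theorem sImage_pow (n : ℕ) : sImage τ ^ n = CrossedProduct.δ τ (Multiplicative.ofAdd n) := by
  refine (map_pow (CrossedProduct.δHom τ) (Multiplicative.ofAdd 1) n).symm.trans ?_
  rw [← ofAdd_nsmul, nsmul_one]
  rfl

/-- Covariance inside `C*(P) ⋊_ω G`, transported by `ι`. -/
theorem uImage_conj (g : G) (a : diagonal φ) :
    uImage τ g * diagonalImage τ a * star (uImage τ g) = diagonalImage τ (omega φ g a) := by
  change CrossedProduct.ι τ _ * CrossedProduct.ι τ (CrossedProduct.ι (omega φ) a) *
    star (CrossedProduct.ι τ _) = CrossedProduct.ι τ (CrossedProduct.ι (omega φ) _)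
  rw [← CrossedProduct.covariance, ← CrossedProduct.ι_star, ← CrossedProduct.ι_mul,
    ← CrossedProduct.ι_mul]

variable {τ}

/-- Covariance at `1` identifies the range projection with `τ_n(1)`, which the defining formula for
`a = 1`, `g = 1` places in `C*(P)`. -/
theorem sImage_pow_mul_star (hτ : IsShiftAction φ τ) (n : ℕ) :
    sImage τ ^ n * star (sImage τ ^ n) = diagonalImage τ (shift φ n 1) := by
  have h := hτ n 1 1
  rw [CrossedProduct.ι_one, CrossedProduct.δ_one, one_mul, iterate_map_one, CrossedProduct.δ_one,
    mul_one] at h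
  change _ = CrossedProduct.ι τ (CrossedProduct.ι (omega φ) (shift φ n 1))
  rw [← h, ← CrossedProduct.covariance, CrossedProduct.ι_one, mul_one, sImage_pow]

theorem uImage_conj_sImage_pow (hτ : IsShiftAction φ τ) (g : G) (n : ℕ) :
    uImage τ g * sImage τ ^ n * star (sImage τ) ^ n * uImage τ g⁻¹
      = diagonalImage τ (omega φ g (shift φ n 1)) := by
  rw [← uImage_conj, ← sImage_pow_mul_star hτ, star_uImage, star_pow]
  simp only [mul_assoc]

/-- Write `S`, `U_g` for the two images. Covariance gives `S U_g = τ_1(δ_g) S = S S⋆ U_{φ(g)} S`.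
The projection `S S⋆` is the copy of `s s⋆`, which `ω_{φ(g)}` fixes, so it commutes with `U_{φ(g)}`;
then `S⋆ S = 1` removes it. -/
theorem sImage_mul_uImage (hτ : IsShiftAction φ τ) (g : G) :
    sImage τ * uImage τ g = uImage τ (φ g) * sImage τ := by
  have h := hτ 1 1 g
  rw [CrossedProduct.ι_one, one_mul, Function.iterate_one] at h
  have hp : diagonalImage τ (shift φ 1 1) = sImage τ * star (sImage τ) := by
    rw [← sImage_pow_mul_star hτ, pow_one]
  have hω : omega φ (φ g) (shift φ 1 1) = shift φ 1 1 :=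
    (omega_shift φ 1 g 1).trans (by rw [omega_one])
  have hc := uImage_conj τ (φ g) (shift φ 1 1)
  rw [hω, hp] at hc
  calc sImage τ * uImage τ g
      = sImage τ * star (sImage τ) * uImage τ (φ g) * sImage τ := by
        rw [sImage, uImage, CrossedProduct.δ_mul_ι, h, CrossedProduct.ι_mul]
        exact congrArg (· * uImage τ (φ g) * sImage τ) hp
    _ = uImage τ (φ g) * (sImage τ * star (sImage τ))
          * (star (uImage τ (φ g)) * uImage τ (φ g)) * sImage τ := by
        nth_rw 1 [← hc]; simp only [mul_assoc]
    _ = uImage τ (φ g) * sImage τ * (star (sImage τ) * sImage τ) := by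
        rw [star_uImage_mul, mul_one]; simp only [mul_assoc]
    _ = uImage τ (φ g) * sImage τ := by rw [star_sImage_mul, mul_one]

/-- The summands in `𝕌[φ]` are the elements `ω_q(s s⋆)` of `C*(P)`, so the identity already holds
there and is carried over by a unital homomorphism. -/
theorem sum_uImage_conj (hτ : IsShiftAction φ τ) :
    ∑ q : G ⧸ φ.range, uImage τ q.out * sImage τ * star (sImage τ) * uImage τ (q.out)⁻¹ = 1 := by
  have h : ∑ q : G ⧸ φ.range, omega φ q.out (shift φ 1 1) = 1 := Subtype.ext (by
    rw [AddSubmonoidClass.coe_finsetSum, OneMemClass.coe_one, ← sum_projections_eq_one φ]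
    refine Finset.sum_congr rfl fun q _ => ?_
    rw [omega_apply_coe, shift_apply_coe, star_u, OneMemClass.coe_one, mul_one, pow_one]
    simp only [mul_assoc])
  rw [← map_one (diagonalImage τ), ← h, map_sum]
  refine Finset.sum_congr rfl fun q _ => ?_
  rw [← uImage_conj_sImage_pow hτ, pow_one, pow_one]

variable (τ) in
/-- The images of the generators of `𝕌[φ]` in `(C*(P) ⋊_ω G) ⋊_τ ℕ`. -/
def genImage : EndoGen G → CrossedProduct τ
  | .u g => uImage τ g
  | .s => sImage τ

/-- The homomorphism of `𝕌[φ]` to `(C*(P) ⋊_ω G) ⋊_τ ℕ`. -/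
def toDoubleCrossed (hτ : IsShiftAction φ τ) : EndoAlgebra φ →⋆ₐ[ℂ] CrossedProduct τ :=
  Universal.desc (genImage τ)
    (fun x => by
      cases x with
      | u g => exact CrossedProduct.norm_le_one_of_isometry (star_uImage_mul τ g)
      | s => exact CrossedProduct.norm_le_one_of_isometry (star_sImage_mul τ))
    (fun a b hab => by
      cases hab <;> simp only [map_mul, map_star, map_one, map_sum, FreeStar.lift_gen, genImage,
        star_uImage_mul, star_sImage_mul, sImage_mul_uImage hτ, uImage_mul, sum_uImage_conj hτ]
      -- The relation left over is `u_g u_g⋆ = 1`.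
      rw [star_uImage, uImage_mul, mul_inv_cancel, uImage_one])

theorem toDoubleCrossed_u (hτ : IsShiftAction φ τ) (g : G) :
    toDoubleCrossed hτ (u φ g) = uImage τ g :=
  Universal.desc_gen _ _ _ _

theorem toDoubleCrossed_s (hτ : IsShiftAction φ τ) : toDoubleCrossed hτ (s φ) = sImage τ :=
  Universal.desc_gen _ _ _ _

/-- By continuity it suffices to compare on `P`. There `u_g sⁿ s⋆ⁿ u_{g⁻¹} = ω_g(sⁿ s⋆ⁿ)`, and
`uImage_conj_sImage_pow` computes its canonical image. -/
theorem toDoubleCrossed_diagonal (hτ : IsShiftAction φ τ) (a : diagonal φ) :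
    toDoubleCrossed hτ a = diagonalImage τ a := by
  have h : (toDoubleCrossed hτ).comp (diagonal φ).subtype = diagonalImage τ := by
    have hc (f : diagonal φ →⋆ₐ[ℂ] CrossedProduct τ) : Continuous f :=
      Universal.continuous_nonUnitalStarAlgHom (f : diagonal φ →⋆ₙₐ[ℂ] CrossedProduct τ)
    refine StarAlgHom.ext_topologicalClosure (hc _) (hc _)
      (StarAlgHom.ext_adjoin fun x hx => ?_)
    obtain ⟨x, hx'⟩ := x
    obtain ⟨g, n, rfl⟩ := hx
    have hd : StarSubalgebra.inclusion (StarSubalgebra.le_topologicalClosure _) ⟨_, hx'⟩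
        = omega φ g (shift φ n 1) := Subtype.ext (by
      rw [omega_apply_coe, shift_apply_coe, star_u, OneMemClass.coe_one, mul_one, star_pow]
      simp only [mul_assoc]
      rfl)
    change toDoubleCrossed hτ (u φ g * s φ ^ n * star (s φ) ^ n * u φ g⁻¹) = diagonalImage τ
      (StarSubalgebra.inclusion (StarSubalgebra.le_topologicalClosure _) _)
    rw [hd, ← uImage_conj_sImage_pow hτ]
    simp only [map_mul, map_pow, map_star, toDoubleCrossed_u, toDoubleCrossed_s]
  exact DFunLike.congr_fun h a

/-- Half of one inverse identity: the other half concerns only the powers of the isometry. -/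
theorem toDoubleCrossed_ofCrossed (hτ : IsShiftAction φ τ) (b : CrossedProduct (omega φ)) :
    toDoubleCrossed hτ (ofCrossed φ b) = CrossedProduct.ι τ b := by
  have h : (toDoubleCrossed hτ).comp (ofCrossed φ) = CrossedProduct.ιHom τ :=
    CrossedProduct.hom_ext
      (fun a => (congrArg _ (ofCrossed_ι a)).trans (toDoubleCrossed_diagonal hτ a))
      fun g => (congrArg _ (ofCrossed_δ g)).trans (toDoubleCrossed_u hτ g)
  exact DFunLike.congr_fun h b

end toDoubleCrossed

/-- The isomorphism of `𝕌[φ]` with `(C*(P) ⋊_ω G) ⋊_τ ℕ`. -/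
def equivDoubleCrossed (hτ : IsShiftAction φ τ) : EndoAlgebra φ ≃⋆ₐ[ℂ] CrossedProduct τ :=
  StarAlgEquiv.ofStarAlgHom (toDoubleCrossed hτ) (ofDoubleCrossed hτ)
    (Universal.hom_ext fun x => by
      cases x with
      | u g =>
        change ofDoubleCrossed hτ (toDoubleCrossed hτ (u φ g)) = u φ g
        rw [toDoubleCrossed_u, uImage, ofDoubleCrossed_ι, ofCrossed_δ]
      | s =>
        change ofDoubleCrossed hτ (toDoubleCrossed hτ (s φ)) = s φ
        rw [toDoubleCrossed_s, sImage, ofDoubleCrossed_δ, pow_one])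
    (CrossedProduct.hom_ext
      (fun b => (congrArg _ (ofDoubleCrossed_ι hτ b)).trans (toDoubleCrossed_ofCrossed hτ b))
      fun n => by
        change toDoubleCrossed hτ (ofDoubleCrossed hτ (CrossedProduct.δ τ
          (Multiplicative.ofAdd n.toAdd))) = CrossedProduct.δ τ (Multiplicative.ofAdd n.toAdd)
        rw [ofDoubleCrossed_δ, map_pow, toDoubleCrossed_s, sImage_pow])

end EndoAlgebra

end

theorem proposition3p6 {G : Type*} [Group G] [Countable G] (φ : G →* G)
    (hφ : Function.Injective φ) [φ.range.FiniteIndex] :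
    (∃! τ : Multiplicative ℕ →* (CrossedProduct (EndoAlgebra.omega φ) →⋆ₙₐ[ℂ]
        CrossedProduct (EndoAlgebra.omega φ)), EndoAlgebra.IsShiftAction φ τ) ∧
    ∀ τ : Multiplicative ℕ →* (CrossedProduct (EndoAlgebra.omega φ) →⋆ₙₐ[ℂ]
        CrossedProduct (EndoAlgebra.omega φ)), EndoAlgebra.IsShiftAction φ τ →
      Nonempty (EndoAlgebra φ ≃⋆ₐ[ℂ] CrossedProduct τ) :=
  ⟨⟨EndoAlgebra.shiftAction φ, EndoAlgebra.isShiftAction_shiftAction φ,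
    fun _ hτ => hτ.eq_shiftAction⟩, fun _ hτ => ⟨EndoAlgebra.equivDoubleCrossed hτ⟩⟩
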